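/- For $d\in\mathbb N$ and $t>0$ let $B_t=\{x\in\mathbb R^d:\sum_{i=1}^d|x_i|\le t\}$ be the closed $\ell^1$ ball of radius $t$, and for $f:\mathbb Z^d\to\mathbb C$ let \[ \mathcal M_t f(x)=\frac{1}{|B_t\cap\mathbb Z^d|}\sum_{y\in B_t\cap\mathbb Z^d} f(x-y),\qquad x\in\mathbb Z^d, \] where $|B_t\cap\mathbb Z^d|$ is the number of lattice points in $B_t$. Let $\mathbb D=\{2^n:n=0,1,2,\dots\}$ be the set of dyadic integers. Theorem 1.3. For every integer $d\ge 4$ and every $f\in \ell^2(\mathbb Z^d)$ (complex valued), the function $x\mapsto\sup_{t\in\mathbb D,\ t\le\sqrt d}|\mathcal M_t f(x)|$ belongs to $\ell^2(\mathbb Z^d)$ and \[ \Big\|\sup_{t\in\mathbb D,\ t\le\sqrt d}|\mathcal M_t f|\Big\|_{\ell^2(\mathbb Z^d)}\le 900\,\|f\|_{\ell^2(\mathbb Z^d)}. \] In particular the bound does not depend on the dimension $d$. -/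

import Mathlib

/-- The closed `l¹` ball `B_t = {x ∈ ℝ^d : ∑ |x_i| ≤ t}`. -/
def l1Ball (d : ℕ) (t : ℝ) : Set (Fin d → ℝ) :=
  {x | ∑ i, |x i| ≤ t}

/-- The set `B_t ∩ ℤ^d` of lattice points of the `l¹` ball. -/
def latticeBall (d : ℕ) (t : ℝ) : Set (Fin d → ℤ) :=
  {y | (fun i => (y i : ℝ)) ∈ l1Ball d t}

theorem latticeBall_finite (d : ℕ) (t : ℝ) : (latticeBall d t).Finite := by
  apply (Set.finite_Icc (fun _ : Fin d => -⌊t⌋) (fun _ : Fin d => ⌊t⌋)).subset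
  intro y hy
  have hy' : ∑ i, |(y i : ℝ)| ≤ t := hy
  have h : ∀ i, |y i| ≤ ⌊t⌋ := by
    intro i
    rw [Int.le_floor, Int.cast_abs]
    exact (Finset.single_le_sum (f := fun i => |(y i : ℝ)|)
      (fun j _ => abs_nonneg _) (Finset.mem_univ i)).trans hy'
  exact ⟨fun i => (abs_le.mp (h i)).1, fun i => (abs_le.mp (h i)).2⟩

/-- `B_t ∩ ℤ^d` as a finite set. -/
noncomputable def latticeBallFinset (d : ℕ) (t : ℝ) : Finset (Fin d → ℤ) :=
  (latticeBall_finite d t).toFinset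

/-- The discrete Hardy–Littlewood averaging operator of the `l¹` ball,
`𝓜_t f(x) = |B_t ∩ ℤ^d|⁻¹ ∑_{y ∈ B_t ∩ ℤ^d} f(x - y)`. -/
noncomputable def discreteAvg {d : ℕ} (t : ℝ) (f : (Fin d → ℤ) → ℂ) (x : Fin d → ℤ) : ℂ :=
  (1 / ((latticeBallFinset d t).card : ℂ)) * ∑ y ∈ latticeBallFinset d t, f (x - y)

/-- The dyadic integers `𝔻 = {2^n : n = 0, 1, 2, …}`, as real numbers. -/
def dyadicRadii : Set ℝ :=
  {t | ∃ n : ℕ, t = 2 ^ n}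

/-- The dyadic radii `t ∈ 𝔻` with `t ≤ √d`. -/
def smallDyadicRadii (d : ℕ) : Set ℝ :=
  {t | t ∈ dyadicRadii ∧ t ≤ √(d : ℝ)}

/-- There are only finitely many radii, so the supremum in `smallDyadicMax` is a genuine one. -/
theorem smallDyadicRadii_finite (d : ℕ) : (smallDyadicRadii d).Finite := by
  apply ((Set.finite_Iic d).image (fun n : ℕ => (2 : ℝ) ^ n)).subset
  rintro t ⟨⟨n, rfl⟩, ht⟩
  refine ⟨n, ?_, rfl⟩
  have h1 : (n : ℝ) ≤ 2 ^ n := by exact_mod_cast Nat.lt_two_pow_self.le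
  have h2 := Real.le_sqrt' (x := (2 : ℝ) ^ n) (y := d) (by positivity) |>.mp ht
  have h3 : (1 : ℝ) ≤ 2 ^ n := one_le_pow₀ (by norm_num)
  have h4 : (n : ℝ) ≤ d := by nlinarith
  exact_mod_cast h4

/-- The maximal function `x ↦ sup_{t ∈ 𝔻, t ≤ √d} |𝓜_t f(x)|`. -/
noncomputable def smallDyadicMax {d : ℕ} (f : (Fin d → ℤ) → ℂ) (x : Fin d → ℤ) : ℝ :=
  ⨆ t : smallDyadicRadii d, ‖discreteAvg (t : ℝ) f x‖

open scoped InnerProductSpace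

/-! Replacing `f` by `|f|`, one looks for a single `W` in `ℓ²` that dominates every average. When
`N² ≤ d`, a typical point of the ball of radius `N` has all entries in `{-1, 0, 1}`. The sum of `f`
over the sign vectors with `k` nonzero entries is at most `(2d)^k / k!` times the `k`-th power of
the simple random walk operator (`sum_signVectors_le_walk_pow`), while the ball has at least `(2d)^N
/ (2 N!)` points (`card_ball_ge`). An arbitrary point is a sparse vector `y` without entries `±1`
plus a sign vector. The points over `y` cost a factor of order `q^|y|` with `q = 1/(2√d)`, and these
weights have sum at most `e`, because nonzero entries of `y` have size at least 2
(`sum_sparseVectors_pow_le`).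

What remains is Stein's maximal theorem for powers of a positive symmetric contraction
(`exists_power_majorant`), with a constant free of `d`. Dyadic Cesàro means are handled by
linearisation and `TT*` (`norm_select_sq_le`, `norm_select_le`); powers differ from Cesàro means by
a square function (`exists_square_function_majorant`). -/

/-- The real Hilbert space `ℓ²(X)`. -/
abbrev RealL2 (X : Type*) : Type _ := lp (fun _ : X => ℝ) 2

namespace RealL2

variable {X : Type*}

theorem inner_eq_tsum_mul (f g : RealL2 X) : ⟪f, g⟫_ℝ = ∑' x, f x * g x := by
  rw [lp.inner_eq_tsum]
  exact tsum_congr fun x => by simp [mul_comm]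

theorem summable_mul (f g : RealL2 X) : Summable fun x => f x * g x := by
  refine (lp.summable_inner (𝕜 := ℝ) f g).congr fun x => ?_
  simp [mul_comm]

theorem norm_sq_eq_tsum (f : RealL2 X) : ‖f‖ ^ 2 = ∑' x, f x ^ 2 := by
  rw [← real_inner_self_eq_norm_sq, inner_eq_tsum_mul]
  exact tsum_congr fun x => (sq _).symm

theorem summable_sq (f : RealL2 X) : Summable fun x => f x ^ 2 :=
  (summable_mul f f).congr fun _ => (sq _).symm

theorem memℓp_of_summable_sq {u : X → ℝ} (h : Summable fun x => u x ^ 2) : Memℓp u 2 := by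
  refine memℓp_gen ?_
  simpa using h

theorem norm_le_of_abs_le {f g : RealL2 X} (h : ∀ x, |f x| ≤ |g x|) : ‖f‖ ≤ ‖g‖ :=
  lp.norm_mono (by norm_num) h

theorem inner_nonneg {f g : RealL2 X} (hf : ∀ x, 0 ≤ f x) (hg : ∀ x, 0 ≤ g x) :
    0 ≤ ⟪f, g⟫_ℝ := by
  rw [inner_eq_tsum_mul]
  exact tsum_nonneg fun x => mul_nonneg (hf x) (hg x)

theorem inner_le_inner {f g h : RealL2 X} (hf : ∀ x, 0 ≤ f x) (hg : ∀ x, g x ≤ h x) :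
    ⟪f, g⟫_ℝ ≤ ⟪f, h⟫_ℝ := by
  rw [← sub_nonneg, ← inner_sub_right]
  exact inner_nonneg hf fun x => by simpa using hg x

theorem sum_apply {ι : Type*} (s : Finset ι) (g : ι → RealL2 X) (x : X) :
    (∑ i ∈ s, g i) x = ∑ i ∈ s, g i x := by
  rw [lp.coeFn_sum, Finset.sum_apply]

/-- Restriction of `f` to a set, as an element of `ℓ²`. -/
noncomputable def restrict (s : Set X) (f : RealL2 X) : RealL2 X :=
  ⟨s.indicator f, (lp.memℓp f).mono' fun x => by
    by_cases h : x ∈ s <;> simp [h]⟩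

theorem restrict_apply (s : Set X) (f : RealL2 X) (x : X) : restrict s f x = s.indicator f x := rfl

theorem restrict_nonneg {s : Set X} {f : RealL2 X} (hf : ∀ x, 0 ≤ f x) (x : X) :
    0 ≤ restrict s f x := Set.indicator_nonneg (fun y _ => hf y) x

theorem inner_restrict_left (s : Set X) (f g : RealL2 X) :
    ⟪restrict s f, g⟫_ℝ = ⟪f, restrict s g⟫_ℝ := by
  rw [inner_eq_tsum_mul, inner_eq_tsum_mul]
  refine tsum_congr fun x => ?_
  by_cases h : x ∈ s <;> simp [restrict_apply, h]

theorem norm_restrict_le (s : Set X) (f : RealL2 X) : ‖restrict s f‖ ≤ ‖f‖ :=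
  norm_le_of_abs_le fun x => by
    by_cases h : x ∈ s <;> simp [restrict_apply, h]

/-- The function `x ↦ g_{ν(x)}(x)` for a selection `ν` with values in `{0, …, J}`. -/
noncomputable def select (J : ℕ) (ν : X → ℕ) (g : ℕ → RealL2 X) : RealL2 X :=
  ∑ n ∈ Finset.range (J + 1), restrict {x | ν x = n} (g n)

theorem select_apply {J : ℕ} {ν : X → ℕ} (hν : ∀ x, ν x ≤ J) (g : ℕ → RealL2 X) (x : X) :
    select J ν g x = g (ν x) x := by
  rw [select, sum_apply, Finset.sum_eq_single (ν x)]
  · simp [restrict_apply]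
  · intro n _ hn
    simp [restrict_apply, Ne.symm hn]
  · intro h
    exact absurd (Finset.mem_range.mpr (Nat.lt_succ_of_le (hν x))) h

/-! ### Positive symmetric contractions and the dyadic Cesàro maximal inequality -/

/-- Positive symmetric contractions of `ℓ²`. -/
structure IsSymmPosContraction (T : RealL2 X →ₗ[ℝ] RealL2 X) : Prop where
  symm : ∀ f g, ⟪T f, g⟫_ℝ = ⟪f, T g⟫_ℝ
  nonneg : ∀ f, (∀ x, 0 ≤ f x) → ∀ x, 0 ≤ T f x
  norm_le : ∀ f, ‖T f‖ ≤ ‖f‖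

namespace IsSymmPosContraction

variable {T : RealL2 X →ₗ[ℝ] RealL2 X}

theorem pow (hT : IsSymmPosContraction T) (k : ℕ) : IsSymmPosContraction (T ^ k) := by
  induction k with
  | zero => exact ⟨fun f g => rfl, fun f hf => hf, fun f => le_rfl⟩
  | succ k ih =>
    refine ⟨fun f g => ?_, fun f hf => ?_, fun f => ?_⟩
    · have h1 : (T ^ (k + 1)) f = (T ^ k) (T f) := by rw [pow_succ]; rfl
      have h2 : (T ^ (k + 1)) g = T ((T ^ k) g) := by rw [pow_succ']; rfl
      rw [h1, h2, ih.symm, hT.symm]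
    · rw [pow_succ]
      exact ih.nonneg _ (hT.nonneg f hf)
    · rw [pow_succ]
      exact (ih.norm_le _).trans (hT.norm_le f)

end IsSymmPosContraction

/-- The Cesàro mean `N⁻¹ ∑_{k < N} T^k`. -/
noncomputable def cesaro (T : RealL2 X →ₗ[ℝ] RealL2 X) (N : ℕ) : RealL2 X →ₗ[ℝ] RealL2 X :=
  (N : ℝ)⁻¹ • ∑ k ∈ Finset.range N, T ^ k

theorem cesaro_apply (T : RealL2 X →ₗ[ℝ] RealL2 X) (N : ℕ) (f : RealL2 X) :
    cesaro T N f = (N : ℝ)⁻¹ • ∑ k ∈ Finset.range N, (T ^ k) f := by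
  simp [cesaro, LinearMap.sum_apply]

theorem cesaro_apply_apply (T : RealL2 X →ₗ[ℝ] RealL2 X) (N : ℕ) (f : RealL2 X) (x : X) :
    cesaro T N f x = (N : ℝ)⁻¹ * ∑ k ∈ Finset.range N, (T ^ k) f x := by
  rw [cesaro_apply, lp.coeFn_smul, Pi.smul_apply, sum_apply, smul_eq_mul]

namespace IsSymmPosContraction

variable {T : RealL2 X →ₗ[ℝ] RealL2 X}

theorem cesaro (hT : IsSymmPosContraction T) (N : ℕ) :
    IsSymmPosContraction (RealL2.cesaro T N) := by
  refine ⟨fun f g => ?_, fun f hf x => ?_, fun f => ?_⟩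
  · simp only [cesaro_apply, inner_smul_left, inner_smul_right, sum_inner, inner_sum,
      (hT.pow _).symm]
    simp
  · rw [cesaro_apply_apply]
    exact mul_nonneg (by positivity) (Finset.sum_nonneg fun k _ => (hT.pow k).nonneg f hf x)
  · rw [cesaro_apply, norm_smul]
    have h : ‖∑ k ∈ Finset.range N, (T ^ k) f‖ ≤ N * ‖f‖ := by
      refine (norm_sum_le _ _).trans ?_
      refine (Finset.sum_le_sum fun k _ => (hT.pow k).norm_le f).trans ?_
      simp
    rw [norm_inv, Real.norm_natCast]
    rcases Nat.eq_zero_or_pos N with rfl | hN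
    · simp
    · have : (0 : ℝ) < N := by exact_mod_cast hN
      calc (N : ℝ)⁻¹ * ‖∑ k ∈ Finset.range N, (T ^ k) f‖ ≤ (N : ℝ)⁻¹ * (N * ‖f‖) := by gcongr
        _ = ‖f‖ := by field_simp

/-- For `j < M ≤ N` the exponents in `T^j` applied to the `N`-th mean are distinct and below `2N`.
By positivity the missing powers may be added, and `1/N = 2/(2N)`. -/
theorem cesaro_cesaro_le (hT : IsSymmPosContraction T) {M N : ℕ} (hMN : M ≤ N) (hM : 0 < M)
    {f : RealL2 X} (hf : ∀ x, 0 ≤ f x) (x : X) :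
    RealL2.cesaro T M (RealL2.cesaro T N f) x ≤ 2 * RealL2.cesaro T (2 * N) f x := by
  have hN : (0 : ℝ) < N := by exact_mod_cast hM.trans_le hMN
  have hM' : (0 : ℝ) < M := by exact_mod_cast hM
  have hterm : ∀ j ∈ Finset.range M, (T ^ j) (RealL2.cesaro T N f) x ≤
      (N : ℝ)⁻¹ * ∑ k ∈ Finset.range (2 * N), (T ^ k) f x := by
    intro j hj
    have hj' := Finset.mem_range.mp hj
    have hcomp : ∀ k, (T ^ j) ((T ^ k) f) = (T ^ (j + k)) f := fun k => by rw [pow_add]; rfl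
    rw [cesaro_apply, map_smul, map_sum, lp.coeFn_smul, Pi.smul_apply, sum_apply, smul_eq_mul]
    refine mul_le_mul_of_nonneg_left ?_ (by positivity)
    simp only [hcomp]
    rw [← Finset.sum_image (s := Finset.range N) (g := fun k => j + k)
      (f := fun k => (T ^ k) f x) (fun a _ b _ h => by simpa using h)]
    refine Finset.sum_le_sum_of_subset_of_nonneg ?_ fun k _ _ => (hT.pow k).nonneg f hf x
    intro k hk
    obtain ⟨a, ha, rfl⟩ := Finset.mem_image.mp hk
    have := Finset.mem_range.mp ha
    exact Finset.mem_range.mpr (by omega)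
  rw [cesaro_apply_apply T M, cesaro_apply_apply T (2 * N)]
  calc (M : ℝ)⁻¹ * ∑ j ∈ Finset.range M, (T ^ j) (RealL2.cesaro T N f) x
      ≤ (M : ℝ)⁻¹ * ∑ _j ∈ Finset.range M,
          (N : ℝ)⁻¹ * ∑ k ∈ Finset.range (2 * N), (T ^ k) f x := by
        gcongr with j hj
        exact hterm j hj
    _ = _ := by
        rw [Finset.sum_const, Finset.card_range, nsmul_eq_mul]
        push_cast
        field_simp

end IsSymmPosContraction

theorem sum_restrict_eq {J : ℕ} {ν : X → ℕ} (hν : ∀ x, ν x ≤ J) (F : RealL2 X) :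
    ∑ n ∈ Finset.range (J + 1), restrict {x | ν x = n} F = F :=
  lp.ext (funext fun x => select_apply hν (fun _ => F) x)

theorem inner_select (J : ℕ) (ν : X → ℕ) (g : ℕ → RealL2 X) (F : RealL2 X) :
    ⟪F, select J ν g⟫_ℝ =
      ∑ n ∈ Finset.range (J + 1), ⟪restrict {x | ν x = n} F, g n⟫_ℝ := by
  simp only [select, inner_sum, inner_restrict_left]

namespace IsSymmPosContraction

variable {T : RealL2 X →ₗ[ℝ] RealL2 X}

theorem inner_cesaro_cesaro_le (hT : IsSymmPosContraction T) {M N : ℕ} (hMN : M ≤ N) (hM : 0 < M)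
    {f g : RealL2 X} (hf : ∀ x, 0 ≤ f x) (hg : ∀ x, 0 ≤ g x) :
    ⟪RealL2.cesaro T M f, RealL2.cesaro T N g⟫_ℝ ≤ 2 * ⟪f, RealL2.cesaro T (2 * N) g⟫_ℝ := by
  rw [(hT.cesaro M).symm, ← real_inner_smul_right]
  exact inner_le_inner hf fun x => by simpa using hT.cesaro_cesaro_le hMN hM hg x

/-- One step of the `TT*` argument for the linearised dyadic Cesàro maximal function. -/
theorem norm_select_sq_le (hT : IsSymmPosContraction T) {J : ℕ} {K : ℝ}
    (hK : ∀ ν : X → ℕ, (∀ x, ν x ≤ J) → ∀ f : RealL2 X, (∀ x, 0 ≤ f x) →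
      ‖select J ν fun n => RealL2.cesaro T (2 ^ n) f‖ ≤ K * ‖f‖)
    {ν : X → ℕ} (hν : ∀ x, ν x ≤ J) {f : RealL2 X} (hf : ∀ x, 0 ≤ f x) :
    ‖select J ν fun n => RealL2.cesaro T (2 ^ n) f‖ ^ 2 ≤ 4 * (K + 1) * ‖f‖ ^ 2 := by
  set A : ℕ → RealL2 X →ₗ[ℝ] RealL2 X := fun n => RealL2.cesaro T (2 ^ n) with hA
  have hAp : ∀ n, IsSymmPosContraction (A n) := fun n => hT.cesaro _
  set F : RealL2 X := select J ν fun n => A n f with hF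
  have hF0 : ∀ x, 0 ≤ F x := fun x => by
    rw [hF, select_apply hν]
    exact (hAp _).nonneg f hf x
  set P : ℕ → RealL2 X := fun n => restrict {x | ν x = n} F with hP
  have hP0 : ∀ n x, 0 ≤ P n x := fun n x => restrict_nonneg hF0 x
  set G : RealL2 X := ∑ n ∈ Finset.range (J + 1), A n (P n) with hG
  set b : ℕ → ℕ → ℝ := fun n m => ⟪P n, A (n + 1) (P m)⟫_ℝ with hb
  have hb0 : ∀ n m, 0 ≤ b n m := fun n m => inner_nonneg (hP0 n) ((hAp _).nonneg _ (hP0 m))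
  -- `G` is the adjoint of the linearised operator applied to `F`.
  have hdual : ‖F‖ ^ 2 ≤ ‖G‖ * ‖f‖ := by
    rw [← real_inner_self_eq_norm_sq]
    calc ⟪F, F⟫_ℝ = ⟪G, f⟫_ℝ := by
          conv_lhs => rw [hF, ← hF, inner_select]
          rw [hG, sum_inner]
          exact Finset.sum_congr rfl fun n _ => ((hAp n).symm _ _).symm
      _ ≤ ‖G‖ * ‖f‖ := real_inner_le_norm _ _
  -- The product of two means is at most twice the mean one scale above the larger index. Only one
  -- of the two terms is needed; adding the other, nonnegative, one makes the bound symmetric.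
  have hpair : ∀ n m, ⟪A n (P n), A m (P m)⟫_ℝ ≤ 2 * b n m + 2 * b m n := by
    intro n m
    rcases le_total n m with h | h
    · have := hT.inner_cesaro_cesaro_le (Nat.pow_le_pow_right two_pos h) (by positivity)
        (hP0 n) (hP0 m)
      have h2 : ⟪P n, A (m + 1) (P m)⟫_ℝ = b m n := by
        rw [← (hAp _).symm, real_inner_comm]
      rw [← pow_succ'] at this
      have h3 := hb0 n m
      simp only [hA] at h2 ⊢
      linarith
    · have := hT.inner_cesaro_cesaro_le (Nat.pow_le_pow_right two_pos h) (by positivity)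
        (hP0 m) (hP0 n)
      have h2 : ⟪P m, A (n + 1) (P n)⟫_ℝ = b n m := by
        rw [← (hAp _).symm, real_inner_comm]
      rw [← pow_succ', real_inner_comm] at this
      have h3 := hb0 m n
      simp only [hA] at h2 ⊢
      linarith
  set L : RealL2 X := select J ν fun n => A (n + 1) F with hL
  have hGsq : ‖G‖ ^ 2 ≤ 4 * ⟪F, L⟫_ℝ := by
    -- Summing over `m` first reassembles the pieces `P m` into `F`.
    have hsum : ∑ n ∈ Finset.range (J + 1), ∑ m ∈ Finset.range (J + 1), b n m = ⟪F, L⟫_ℝ := by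
      rw [hL, inner_select]
      refine Finset.sum_congr rfl fun n _ => ?_
      rw [← inner_sum, ← map_sum]
      simp only [hP, sum_restrict_eq hν]
    rw [← real_inner_self_eq_norm_sq, hG, sum_inner]
    simp only [inner_sum]
    calc _ ≤ ∑ n ∈ Finset.range (J + 1), ∑ m ∈ Finset.range (J + 1), (2 * b n m + 2 * b m n) :=
          Finset.sum_le_sum fun n _ => Finset.sum_le_sum fun m _ => hpair n m
      _ = 4 * ⟪F, L⟫_ℝ := by
          simp only [Finset.sum_add_distrib, ← Finset.mul_sum]
          rw [Finset.sum_comm (f := fun n m => b m n), hsum]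
          ring
  have hLn : ‖L‖ ≤ (K + 1) * ‖F‖ := by
    -- The shifted selection may reach scale `J + 1`, outside the range of `hK`. That single scale
    -- is a contraction and accounts for the `+ 1` in `K + 1`.
    have hν' : ∀ x, min (ν x + 1) J ≤ J := fun x => min_le_right _ _
    have h1 := hK (fun x => min (ν x + 1) J) hν' F hF0
    have h2 := (hAp (J + 1)).norm_le F
    have h3 : ‖L‖ ≤ ‖(select J (fun x => min (ν x + 1) J) fun n => A n F) + A (J + 1) F‖ := by
      refine norm_le_of_abs_le fun x => ?_
      have e1 : 0 ≤ A (min (ν x + 1) J) F x := (hAp _).nonneg _ hF0 x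
      have e2 : 0 ≤ A (J + 1) F x := (hAp _).nonneg _ hF0 x
      have e3 : 0 ≤ A (ν x + 1) F x := (hAp _).nonneg _ hF0 x
      rw [lp.coeFn_add, Pi.add_apply, hL, select_apply hν, select_apply hν', abs_of_nonneg e3,
        abs_of_nonneg (add_nonneg e1 e2)]
      rcases Nat.lt_or_ge (ν x) J with h | h
      · rw [min_eq_left h]
        linarith
      · rw [le_antisymm (hν x) h]
        linarith [show 0 ≤ A (min (J + 1) J) F x from (hAp _).nonneg _ hF0 x]
    calc ‖L‖ ≤ _ := h3
      _ ≤ _ := norm_add_le _ _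
      _ ≤ K * ‖F‖ + ‖F‖ := add_le_add h1 h2
      _ = _ := by ring
  have hFL : ⟪F, L⟫_ℝ ≤ (K + 1) * ‖F‖ ^ 2 := by
    calc ⟪F, L⟫_ℝ ≤ ‖F‖ * ‖L‖ := real_inner_le_norm _ _
      _ ≤ ‖F‖ * ((K + 1) * ‖F‖) := by gcongr
      _ = _ := by ring
  rcases (norm_nonneg F).eq_or_lt with h0 | h0
  -- The sign of `K` is not assumed; `hK` forces it when `f ≠ 0`.
  · have hLF : 0 ≤ (K + 1) * ‖f‖ ^ 2 := by
      rcases (norm_nonneg f).eq_or_lt with h | h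
      · simp [← h]
      · have := (norm_nonneg _).trans (hK ν hν f hf)
        have : 0 ≤ K := nonneg_of_mul_nonneg_left this h
        positivity
    rw [← h0]
    linarith
  · have h1 : ‖F‖ ^ 2 * ‖F‖ ^ 2 ≤ (‖G‖ * ‖f‖) * (‖G‖ * ‖f‖) :=
      mul_self_le_mul_self (by positivity) hdual
    have h2 : ‖G‖ ^ 2 * ‖f‖ ^ 2 ≤ (4 * ((K + 1) * ‖F‖ ^ 2)) * ‖f‖ ^ 2 := by
      gcongr
      linarith
    refine le_of_mul_le_mul_left ?_ (show 0 < ‖F‖ ^ 2 by positivity)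
    calc ‖F‖ ^ 2 * ‖F‖ ^ 2 ≤ (‖G‖ * ‖f‖) * (‖G‖ * ‖f‖) := h1
      _ = ‖G‖ ^ 2 * ‖f‖ ^ 2 := by ring
      _ ≤ _ := h2
      _ = _ := by ring

/-- The linearised dyadic Cesàro maximal function is bounded with a constant independent of the
number of scales. -/
theorem norm_select_le (hT : IsSymmPosContraction T) {J : ℕ}
    {ν : X → ℕ} (hν : ∀ x, ν x ≤ J) {f : RealL2 X} (hf : ∀ x, 0 ≤ f x) :
    ‖select J ν fun n => RealL2.cesaro T (2 ^ n) f‖ ≤ 6 * ‖f‖ := by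
  -- Bootstrap: the constant `K = j + 7` improves to `j + 6`, since `4(K + 1) = 4(j + 8) ≤ (j +
  -- 6)²`. The descent stops at 6 and can start from any finite bound, here the trivial `J + 1`.
  have key : ∀ j : ℕ, (∀ ν : X → ℕ, (∀ x, ν x ≤ J) → ∀ f : RealL2 X, (∀ x, 0 ≤ f x) →
      ‖select J ν fun n => RealL2.cesaro T (2 ^ n) f‖ ≤ ((j : ℝ) + 6) * ‖f‖) →
      ∀ ν : X → ℕ, (∀ x, ν x ≤ J) → ∀ f : RealL2 X, (∀ x, 0 ≤ f x) →
      ‖select J ν fun n => RealL2.cesaro T (2 ^ n) f‖ ≤ 6 * ‖f‖ := by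
    intro j
    induction j with
    | zero => intro h; simpa using h
    | succ j ih =>
      intro h
      refine ih fun ν hν f hf => ?_
      refine abs_le_of_sq_le_sq' ?_ (by positivity) |>.2
      refine (hT.norm_select_sq_le h hν hf).trans ?_
      rw [mul_pow]
      gcongr
      push_cast
      nlinarith [(Nat.cast_nonneg j : (0 : ℝ) ≤ j)]
  refine key (J + 1) (fun ν _ f _ => ?_) ν hν f hf
  have h : ‖select J ν fun n => RealL2.cesaro T (2 ^ n) f‖ ≤ ((J + 1 : ℕ) : ℝ) * ‖f‖ := by
    refine (norm_sum_le _ _).trans ?_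
    refine (Finset.sum_le_sum fun n _ =>
      (norm_restrict_le _ _).trans ((hT.cesaro (2 ^ n)).norm_le f)).trans ?_
    simp
  nlinarith [norm_nonneg f]

/-- Dyadic Cesàro means are dominated by one function of comparable norm. -/
theorem exists_cesaro_majorant (hT : IsSymmPosContraction T) (J : ℕ) {f : RealL2 X}
    (hf : ∀ x, 0 ≤ f x) :
    ∃ C : RealL2 X, ‖C‖ ≤ 6 * ‖f‖ ∧ ∀ n ≤ J, ∀ x, RealL2.cesaro T (2 ^ n) f x ≤ C x := by
  have hmax : ∀ x, ∃ m ≤ J, ∀ n ≤ J,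
      RealL2.cesaro T (2 ^ n) f x ≤ RealL2.cesaro T (2 ^ m) f x := by
    intro x
    obtain ⟨m, hm, h⟩ := Finset.exists_max_image (Finset.range (J + 1))
      (fun n => RealL2.cesaro T (2 ^ n) f x) ⟨0, by simp⟩
    exact ⟨m, Nat.lt_succ_iff.mp (Finset.mem_range.mp hm), fun n hn =>
      h n (Finset.mem_range.mpr (Nat.lt_succ_of_le hn))⟩
  choose ν hν h using hmax
  refine ⟨select J ν fun n => RealL2.cesaro T (2 ^ n) f, hT.norm_select_le hν hf,
    fun n hn x => ?_⟩
  rw [select_apply hν]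
  exact h x n hn

end IsSymmPosContraction

/-! ### From Cesàro means to powers: the square function -/

namespace IsSymmPosContraction

variable {Q : RealL2 X →ₗ[ℝ] RealL2 X}

theorem norm_pow_sub_pow_sq (hQ : IsSymmPosContraction Q) (f : RealL2 X) (j : ℕ) :
    ‖(Q ^ j) f - (Q ^ (j + 2)) f‖ ^ 2 =
      ‖(Q ^ j) f‖ ^ 2 - 2 * ‖(Q ^ (j + 1)) f‖ ^ 2 + ‖(Q ^ (j + 2)) f‖ ^ 2 := by
  have h1 : (Q ^ (j + 1)) f = Q ((Q ^ j) f) := by rw [pow_succ']; rfl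
  have h2 : (Q ^ (j + 2)) f = Q ((Q ^ (j + 1)) f) := by rw [pow_succ' Q (j + 1)]; rfl
  have h : ⟪(Q ^ j) f, (Q ^ (j + 2)) f⟫_ℝ = ‖(Q ^ (j + 1)) f‖ ^ 2 := by
    rw [h2, ← hQ.symm, ← h1, real_inner_self_eq_norm_sq]
  rw [norm_sub_sq_real, h]

/-- The square function estimate for the powers of `T = Q ^ 2`. -/
theorem sum_norm_pow_sub_pow_sq_le (hQ : IsSymmPosContraction Q) (f : RealL2 X) (n : ℕ) :
    ∑ k ∈ Finset.range n, ((k : ℝ) + 1) * ‖(Q ^ (2 * k)) f - (Q ^ (2 * k + 2)) f‖ ^ 2 ≤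
      ‖f‖ ^ 2 := by
  set b : ℕ → ℝ := fun j => ‖(Q ^ j) f‖ ^ 2 with hb
  -- The second difference of `b` is a squared norm, so `b` is convex; this is where `T` being a
  -- square is used.
  have hconv : ∀ j, 0 ≤ b j - 2 * b (j + 1) + b (j + 2) := fun j => by
    rw [← hQ.norm_pow_sub_pow_sq f j]
    positivity
  have hanti : ∀ j, b (j + 1) ≤ b j := fun j => by
    have h1 : (Q ^ (j + 1)) f = Q ((Q ^ j) f) := by rw [pow_succ']; rfl
    simp only [hb, h1]
    gcongr
    exact hQ.norm_le _
  -- In the induction the two sides differ by exactly `n` times the second difference of `b` at `2n`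
  -- plus `2n + 2` times that at `2n + 1`.
  have key : ∀ n : ℕ,
      ∑ k ∈ Finset.range n, ((k : ℝ) + 1) * ‖(Q ^ (2 * k)) f - (Q ^ (2 * k + 2)) f‖ ^ 2 ≤
        b 0 - (2 * n + 1) * b (2 * n) + 2 * n * b (2 * n + 1) := by
    intro n
    induction n with
    | zero => simp
    | succ n ih =>
      rw [Finset.sum_range_succ, hQ.norm_pow_sub_pow_sq]
      have h1 := mul_nonneg (Nat.cast_nonneg n : (0 : ℝ) ≤ n) (hconv (2 * n))
      have h2 := mul_nonneg (by positivity : (0 : ℝ) ≤ 2 * n + 2) (hconv (2 * n + 1))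
      have e : 2 * (n + 1) = 2 * n + 2 := by ring
      have e1 : 2 * n + 1 + 1 = 2 * n + 2 := rfl
      have e2 : 2 * n + 1 + 2 = 2 * n + 3 := rfl
      rw [e1, e2] at h2
      rw [e, show 2 * n + 2 + 1 = 2 * n + 3 from rfl]
      push_cast
      simp only [hb] at *
      nlinarith
  refine (key n).trans ?_
  have h1 := mul_nonneg (Nat.cast_nonneg n : (0 : ℝ) ≤ n) (sub_nonneg.mpr (hanti (2 * n)))
  have h2 : 0 ≤ b (2 * n) := by positivity
  have h3 : b 0 = ‖f‖ ^ 2 := by simp [hb]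
  nlinarith

/-- With `T = Q²` and `D_k = T^k f - T^(k+1) f`, Abel summation gives `T^n f = n⁻¹ ∑_{k<n} T^k f -
n⁻¹ ∑_{k<n} (k+1) D_k`. Cauchy–Schwarz with weights `k + 1`, of total at most `n²`, bounds the last
term by `G = (∑ (k+1) D_k²)^(1/2)`. -/
theorem exists_square_function_majorant (hQ : IsSymmPosContraction Q) (J : ℕ) (f : RealL2 X) :
    ∃ G : RealL2 X, ‖G‖ ≤ ‖f‖ ∧ (∀ x, 0 ≤ G x) ∧ ∀ n ≤ J, 0 < n → ∀ x,
      ((Q ^ 2) ^ n) f x ≤ RealL2.cesaro (Q ^ 2) n f x + G x := by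
  set D : ℕ → RealL2 X := fun k => (Q ^ (2 * k)) f - (Q ^ (2 * k + 2)) f with hD
  set S : X → ℝ := fun x => ∑ k ∈ Finset.range J, ((k : ℝ) + 1) * D k x ^ 2 with hS
  have hS0 : ∀ x, 0 ≤ S x := fun x => Finset.sum_nonneg fun k _ => by positivity
  have hterm : ∀ k ∈ Finset.range J, Summable fun x => ((k : ℝ) + 1) * D k x ^ 2 :=
    fun k _ => (summable_sq (D k)).mul_left _
  have hsum : Summable S := summable_sum hterm
  have hsq : ∀ x, Real.sqrt (S x) ^ 2 = S x := fun x => Real.sq_sqrt (hS0 x)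
  refine ⟨⟨fun x => Real.sqrt (S x), memℓp_of_summable_sq (by simpa only [hsq] using hsum)⟩,
    ?_, fun x => Real.sqrt_nonneg _, fun n hn hn0 x => ?_⟩
  · refine abs_le_of_sq_le_sq' ?_ (norm_nonneg _) |>.2
    rw [norm_sq_eq_tsum]
    simp only [hsq]
    rw [hS, Summable.tsum_finsetSum hterm]
    refine le_trans (le_of_eq ?_) (hQ.sum_norm_pow_sub_pow_sq_le f J)
    refine Finset.sum_congr rfl fun k _ => ?_
    rw [tsum_mul_left, ← norm_sq_eq_tsum]
  · have hnpos : (0 : ℝ) < n := by exact_mod_cast hn0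
    have hDx : ∀ k, D k x = ((Q ^ 2) ^ k) f x - ((Q ^ 2) ^ (k + 1)) f x := fun k => by
      rw [← pow_mul, ← pow_mul, hD]
      simp [mul_add]
    have habel : ∀ m : ℕ, ∑ k ∈ Finset.range m, ((k : ℝ) + 1) * D k x =
        ∑ k ∈ Finset.range m, ((Q ^ 2) ^ k) f x - m * ((Q ^ 2) ^ m) f x := by
      intro m
      induction m with
      | zero => simp
      | succ m ih =>
        rw [Finset.sum_range_succ, Finset.sum_range_succ, ih, hDx]
        push_cast
        ring
    have hcs : (∑ k ∈ Finset.range n, ((k : ℝ) + 1) * D k x) ^ 2 ≤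
        (∑ k ∈ Finset.range n, ((k : ℝ) + 1)) *
          ∑ k ∈ Finset.range n, ((k : ℝ) + 1) * D k x ^ 2 :=
      Finset.sum_sq_le_sum_mul_sum_of_sq_le_mul _ (fun k _ => by positivity)
        (fun k _ => by positivity) (fun k _ => le_of_eq (by ring))
    have hone : ∑ k ∈ Finset.range n, ((k : ℝ) + 1) ≤ n * n := by
      refine (Finset.sum_le_card_nsmul _ _ (n : ℝ) fun k hk => ?_).trans (by simp)
      exact_mod_cast Finset.mem_range.mp hk
    have htwo : ∑ k ∈ Finset.range n, ((k : ℝ) + 1) * D k x ^ 2 ≤ S x :=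
      Finset.sum_le_sum_of_subset_of_nonneg
        (Finset.range_subset_range.mpr hn) fun k _ _ => by positivity
    have hbound : (∑ k ∈ Finset.range n, ((k : ℝ) + 1) * D k x) ^ 2 ≤
        (n * Real.sqrt (S x)) ^ 2 := by
      rw [mul_pow, hsq, sq (n : ℝ)]
      exact hcs.trans (mul_le_mul hone htwo (Finset.sum_nonneg fun k _ => by positivity)
        (by positivity))
    have hlow := (abs_le_of_sq_le_sq' hbound (by positivity)).1
    rw [habel] at hlow
    rw [cesaro_apply_apply]
    change _ ≤ _ + Real.sqrt (S x)
    have : ((Q ^ 2) ^ n) f x = (n : ℝ)⁻¹ * (n * ((Q ^ 2) ^ n) f x) := by field_simp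
    rw [this, show Real.sqrt (S x) = (n : ℝ)⁻¹ * (n * Real.sqrt (S x)) by field_simp, ← mul_add]
    refine mul_le_mul_of_nonneg_left ?_ (by positivity)
    linarith

/-- Rounding `n` up to a power of two at most doubles it, and positivity lets the sum grow. -/
theorem cesaro_le_two_mul_cesaro_dyadic (hQ : IsSymmPosContraction Q) {n : ℕ} (hn : 0 < n)
    {f : RealL2 X} (hf : ∀ x, 0 ≤ f x) (x : X) :
    RealL2.cesaro Q n f x ≤ 2 * RealL2.cesaro Q (2 ^ Nat.clog 2 n) f x := by
  have h1 : n ≤ 2 ^ Nat.clog 2 n := Nat.le_pow_clog one_lt_two n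
  have h2 : 2 ^ Nat.clog 2 n ≤ 2 * n := by
    rcases Nat.lt_or_ge 1 n with h | h
    · have := Nat.pow_pred_clog_lt_self one_lt_two h
      have hpos : 0 < Nat.clog 2 n := Nat.clog_pos one_lt_two h
      have e : 2 ^ Nat.clog 2 n = 2 * 2 ^ (Nat.clog 2 n).pred := by
        rw [← pow_succ', Nat.pred_eq_sub_one, Nat.sub_add_cancel hpos]
      omega
    · simp [Nat.clog_of_right_le_one h]
      omega
  set N := 2 ^ Nat.clog 2 n
  have hN : (0 : ℝ) < N := by exact_mod_cast hn.trans_le h1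
  have hn' : (0 : ℝ) < n := by exact_mod_cast hn
  have h2' : (N : ℝ) ≤ 2 * n := by exact_mod_cast h2
  rw [cesaro_apply_apply, cesaro_apply_apply]
  have hmono : ∑ k ∈ Finset.range n, (Q ^ k) f x ≤ ∑ k ∈ Finset.range N, (Q ^ k) f x :=
    Finset.sum_le_sum_of_subset_of_nonneg (Finset.range_subset_range.mpr h1)
      fun k _ _ => (hQ.pow k).nonneg f hf x
  have hpos : 0 ≤ ∑ k ∈ Finset.range N, (Q ^ k) f x :=
    Finset.sum_nonneg fun k _ => (hQ.pow k).nonneg f hf x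
  rw [← mul_assoc]
  refine mul_le_mul ?_ hmono (Finset.sum_nonneg fun k _ => (hQ.pow k).nonneg f hf x)
    (by positivity)
  rw [inv_le_iff_one_le_mul₀ hn', mul_assoc, mul_comm, mul_assoc, inv_mul_eq_div, one_le_div hN]
  linarith

theorem exists_even_power_majorant (hQ : IsSymmPosContraction Q) (J : ℕ) {f : RealL2 X}
    (hf : ∀ x, 0 ≤ f x) :
    ∃ F : RealL2 X, ‖F‖ ≤ 13 * ‖f‖ ∧ (∀ x, 0 ≤ F x) ∧
      ∀ n ≤ J, ∀ x, ((Q ^ 2) ^ n) f x ≤ F x := by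
  have hT := hQ.pow 2
  obtain ⟨C, hC, hCle⟩ := hT.exists_cesaro_majorant J hf
  obtain ⟨G, hG, hG0, hGle⟩ := hQ.exists_square_function_majorant J f
  -- The mean of length `2^0` is `f` itself; this covers the exponent 0.
  have hC0 : ∀ x, f x ≤ C x := fun x => by
    simpa [cesaro_apply_apply] using hCle 0 (Nat.zero_le _) x
  have hval : ∀ x, ((2 : ℝ) • C + G) x = 2 * C x + G x := fun x => by
    rw [lp.coeFn_add, lp.coeFn_smul]
    rfl
  refine ⟨(2 : ℝ) • C + G, ?_, fun x => ?_, fun n hn x => ?_⟩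
  · calc ‖(2 : ℝ) • C + G‖ ≤ ‖(2 : ℝ) • C‖ + ‖G‖ := norm_add_le _ _
      _ = 2 * ‖C‖ + ‖G‖ := by rw [norm_smul]; simp
      _ ≤ 13 * ‖f‖ := by linarith
  · rw [hval]
    linarith [hf x, hC0 x, hG0 x]
  · rw [hval]
    rcases Nat.eq_zero_or_pos n with rfl | h
    · have : ((Q ^ 2) ^ 0) f x = f x := rfl
      rw [this]
      linarith [hf x, hC0 x, hG0 x]
    · have h1 := hGle n hn h x
      have h2 := hT.cesaro_le_two_mul_cesaro_dyadic h hf x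
      have h3 := hCle (Nat.clog 2 n)
        ((Nat.clog_le_of_le_pow Nat.lt_two_pow_self.le).trans hn) x
      linarith

/-- A maximal theorem for the powers of a positive symmetric contraction. -/
theorem exists_power_majorant (hQ : IsSymmPosContraction Q) (J : ℕ) {f : RealL2 X}
    (hf : ∀ x, 0 ≤ f x) :
    ∃ F : RealL2 X, ‖F‖ ≤ 26 * ‖f‖ ∧ (∀ x, 0 ≤ F x) ∧ ∀ n ≤ J, ∀ x, (Q ^ n) f x ≤ F x := by
  obtain ⟨F, hF, hF0, hFle⟩ := hQ.exists_even_power_majorant J hf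
  -- Odd powers are even powers applied to `Q f`, whence `26 = 13 + 13`.
  obtain ⟨G, hG, hG0, hGle⟩ := hQ.exists_even_power_majorant J (hQ.nonneg f hf)
  have hval : ∀ x, (F + G) x = F x + G x := fun x => by simp
  refine ⟨F + G, ?_, fun x => ?_, fun n hn x => ?_⟩
  · have := hQ.norm_le f
    linarith [norm_add_le F G]
  · rw [hval]
    exact add_nonneg (hF0 x) (hG0 x)
  · rw [hval]
    rcases Nat.even_or_odd' n with ⟨m, rfl | rfl⟩
    · have := hFle m (by omega) x
      rw [pow_mul]
      linarith [hG0 x]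
    · have := hGle m (by omega) x
      rw [pow_succ, pow_mul]
      change ((Q ^ 2) ^ m) (Q f) x ≤ _
      linarith [hF0 x]

end IsSymmPosContraction

end RealL2

/-! ### The simple random walk on `ℤ^d` -/

namespace RealL2

variable {X : Type*} [AddCommGroup X]

/-- Translation by `u` on `ℓ²(X)`. -/
noncomputable def shift (u : X) : RealL2 X →ₗ[ℝ] RealL2 X where
  toFun f := ⟨fun x => f (x - u), memℓp_of_summable_sq
    ((Equiv.subRight u).summable_iff.mpr (summable_sq f))⟩
  map_add' _ _ := rfl
  map_smul' _ _ := rfl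

theorem shift_apply (u : X) (f : RealL2 X) (x : X) : shift u f x = f (x - u) := rfl

theorem norm_shift (u : X) (f : RealL2 X) : ‖shift u f‖ = ‖f‖ := by
  have h : ‖shift u f‖ ^ 2 = ‖f‖ ^ 2 := by
    rw [norm_sq_eq_tsum, norm_sq_eq_tsum]
    exact (Equiv.subRight u).tsum_eq fun x => f x ^ 2
  exact (pow_left_inj₀ (norm_nonneg _) (norm_nonneg _) two_ne_zero).mp h

theorem inner_shift_left (u : X) (f g : RealL2 X) :
    ⟪shift u f, g⟫_ℝ = ⟪f, shift (-u) g⟫_ℝ := by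
  rw [inner_eq_tsum_mul, inner_eq_tsum_mul,
    ← (Equiv.subRight u).tsum_eq fun x => f x * shift (-u) g x]
  refine tsum_congr fun x => ?_
  simp [shift_apply]

/-- The transition operator of the simple random walk on `ℤ^d`. -/
noncomputable def walk (d : ℕ) : RealL2 (Fin d → ℤ) →ₗ[ℝ] RealL2 (Fin d → ℤ) :=
  (2 * d : ℝ)⁻¹ • ∑ i : Fin d, (shift (Pi.single i 1) + shift (Pi.single i (-1)))

theorem walk_eq {d : ℕ} (f : RealL2 (Fin d → ℤ)) :
    walk d f = (2 * d : ℝ)⁻¹ •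
      ∑ i : Fin d, (shift (Pi.single i 1) f + shift (Pi.single i (-1)) f) := by
  simp [walk, LinearMap.sum_apply]

theorem walk_apply {d : ℕ} (f : RealL2 (Fin d → ℤ)) (x : Fin d → ℤ) :
    walk d f x = (2 * d : ℝ)⁻¹ *
      ∑ i : Fin d, (f (x - Pi.single i 1) + f (x - Pi.single i (-1))) := by
  rw [walk_eq, lp.coeFn_smul, Pi.smul_apply, sum_apply, smul_eq_mul]
  rfl

theorem isSymmPosContraction_walk (d : ℕ) : IsSymmPosContraction (walk d) := by
  refine ⟨fun f g => ?_, fun f hf x => ?_, fun f => ?_⟩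
  · simp only [walk_eq, inner_smul_left, inner_smul_right, sum_inner, inner_sum, inner_add_left,
      inner_add_right, inner_shift_left, ← Pi.single_neg, neg_neg]
    simp [add_comm]
  · rw [walk_apply]
    exact mul_nonneg (by positivity) (Finset.sum_nonneg fun i _ => add_nonneg (hf _) (hf _))
  · rw [walk_eq, norm_smul, norm_inv, Real.norm_of_nonneg (by positivity)]
    have h : ‖∑ i : Fin d, (shift (Pi.single i 1) f + shift (Pi.single i (-1)) f)‖ ≤
        2 * d * ‖f‖ := by
      refine (norm_sum_le_of_le _ fun i _ => (norm_add_le _ _).trans_eq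
        (show _ = 2 * ‖f‖ by rw [norm_shift, norm_shift]; ring)).trans_eq ?_
      simp
      ring
    rcases Nat.eq_zero_or_pos d with rfl | hd
    · simp
    · have hd' : (0 : ℝ) < d := by exact_mod_cast hd
      rw [inv_mul_le_iff₀ (by positivity)]
      exact h

end RealL2

/-! ### Sign vectors: counting and comparison with the walk -/

/-- The `ℓ¹` norm of a lattice point. -/
def latticeNorm {d : ℕ} (y : Fin d → ℤ) : ℕ := ∑ i, (y i).natAbs

/-- The vectors with entries in `{-1, 0, 1}` and exactly `k` nonzero entries. -/
def signVectors (d k : ℕ) : Finset (Fin d → ℤ) :=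
  (Fintype.piFinset fun _ => {-1, 0, 1}).filter fun y => latticeNorm y = k

theorem mem_signVectors {d k : ℕ} {y : Fin d → ℤ} :
    y ∈ signVectors d k ↔ (∀ i, y i = -1 ∨ y i = 0 ∨ y i = 1) ∧ latticeNorm y = k := by
  simp [signVectors, Fintype.mem_piFinset]

theorem latticeNorm_add_single {d : ℕ} {y : Fin d → ℤ} {i : Fin d} (hi : y i = 0) (s : ℤ) :
    latticeNorm (y + Pi.single i s) = latticeNorm y + s.natAbs := by
  have h : ∀ j, ((y + Pi.single i s : Fin d → ℤ) j).natAbs =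
      (y j).natAbs + if i = j then s.natAbs else 0 := by
    intro j
    by_cases hj : i = j
    · subst hj
      simp [hi]
    · simp [hj]
  simp only [latticeNorm, h, Finset.sum_add_distrib, Finset.sum_ite_eq, Finset.mem_univ, if_true]

theorem sum_signVectors_filter {d k : ℕ} (i : Fin d) {s : ℤ} (hs : s = 1 ∨ s = -1)
    (g : (Fin d → ℤ) → ℝ) :
    ∑ y ∈ (signVectors d (k + 1)).filter (fun y => y i = s), g y =
      ∑ y ∈ (signVectors d k).filter (fun y => y i = 0), g (y + Pi.single i s) := by
  have hs1 : s.natAbs = 1 := by rcases hs with rfl | rfl <;> rfl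
  refine Finset.sum_nbij' (fun y => y - Pi.single i s) (fun y => y + Pi.single i s)
    ?_ ?_ ?_ ?_ ?_
  · intro y hy
    obtain ⟨hy, hyi⟩ := Finset.mem_filter.mp hy
    obtain ⟨h1, h2⟩ := mem_signVectors.mp hy
    have hz : (y - Pi.single i s : Fin d → ℤ) i = 0 := by simp [hyi]
    refine Finset.mem_filter.mpr ⟨mem_signVectors.mpr ⟨fun j => ?_, ?_⟩, hz⟩
    · by_cases hj : j = i
      · subst hj
        exact Or.inr (Or.inl hz)
      · simpa [Pi.single_eq_of_ne hj] using h1 j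
    · have := latticeNorm_add_single hz s
      rw [sub_add_cancel, h2, hs1] at this
      omega
  · intro y hy
    obtain ⟨hy, hyi⟩ := Finset.mem_filter.mp hy
    obtain ⟨h1, h2⟩ := mem_signVectors.mp hy
    refine Finset.mem_filter.mpr ⟨mem_signVectors.mpr ⟨fun j => ?_, ?_⟩, by simp [hyi]⟩
    · by_cases hj : j = i
      · subst hj
        simp only [Pi.add_apply, hyi, Pi.single_eq_same]
        omega
      · simpa [Pi.single_eq_of_ne hj] using h1 j
    · rw [latticeNorm_add_single hyi, h2, hs1]
  · intro y _
    simp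
  · intro y _
    simp
  · intro y _
    simp

/-- Double counting: a sign vector with `k + 1` nonzero entries arises in `k + 1` ways by filling a
zero entry of one with `k`. -/
theorem succ_mul_sum_signVectors {d k : ℕ} (g : (Fin d → ℤ) → ℝ) :
    ((k : ℝ) + 1) * ∑ y ∈ signVectors d (k + 1), g y =
      ∑ i : Fin d, (∑ y ∈ (signVectors d k).filter (fun y => y i = 0), g (y + Pi.single i 1) +
        ∑ y ∈ (signVectors d k).filter (fun y => y i = 0), g (y + Pi.single i (-1))) := by
  simp only [← sum_signVectors_filter _ (Or.inl rfl), ← sum_signVectors_filter _ (Or.inr rfl),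
    Finset.sum_filter, ← Finset.sum_add_distrib]
  rw [Finset.sum_comm, Finset.mul_sum]
  refine Finset.sum_congr rfl fun y hy => ?_
  obtain ⟨h1, h2⟩ := mem_signVectors.mp hy
  have h3 : ∀ i, ((if y i = 1 then g y else 0) + if y i = -1 then g y else 0) =
      ((y i).natAbs : ℝ) * g y := by
    intro i
    rcases h1 i with h | h | h <;> simp [h]
  simp only [h3]
  rw [← Finset.sum_mul]
  congr 1
  exact_mod_cast h2.symm

theorem succ_mul_card_signVectors (d k : ℕ) :
    ((k : ℝ) + 1) * (signVectors d (k + 1)).card =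
      2 * ((d : ℝ) - k) * (signVectors d k).card := by
  have h := succ_mul_sum_signVectors (d := d) (k := k) fun _ => 1
  simp only [Finset.sum_filter, ← Finset.sum_add_distrib] at h
  rw [Finset.sum_comm] at h
  have h2 : ∀ y ∈ signVectors d k, ∑ i : Fin d,
      ((if y i = 0 then (1 : ℝ) else 0) + if y i = 0 then (1 : ℝ) else 0) = 2 * ((d : ℝ) - k) := by
    intro y hy
    obtain ⟨h1, h2⟩ := mem_signVectors.mp hy
    have h3 : ∀ i, ((if y i = 0 then (1 : ℝ) else 0) + if y i = 0 then (1 : ℝ) else 0) =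
        2 * (1 - ((y i).natAbs : ℝ)) := by
      intro i
      rcases h1 i with h | h | h <;> norm_num [h]
    have h4 : ∑ i : Fin d, ((y i).natAbs : ℝ) = k := by exact_mod_cast h2
    simp only [h3]
    rw [← Finset.mul_sum, Finset.sum_sub_distrib, h4]
    simp
  rw [Finset.sum_congr rfl h2] at h
  simpa [mul_comm, mul_left_comm, mul_assoc] using h

/-- The recursion for the cardinalities multiplies the left side by `2(d - k)` at each step, and
`∏_{j<k} (1 - j/d) ≥ 1 - k²/(2d)`. -/
theorem factorial_mul_card_signVectors_ge {d : ℕ} (hd : 0 < d) {k : ℕ} (hk : k ≤ d) :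
    (2 * d : ℝ) ^ k * (1 - (k : ℝ) ^ 2 / (2 * d)) ≤ k.factorial * (signVectors d k).card := by
  have hd' : (0 : ℝ) < d := by exact_mod_cast hd
  induction k with
  | zero =>
    have : 0 < (signVectors d 0).card :=
      Finset.card_pos.mpr ⟨0, mem_signVectors.mpr ⟨fun i => by simp, by simp [latticeNorm]⟩⟩
    have h1 : (1 : ℝ) ≤ (signVectors d 0).card := by exact_mod_cast this
    simpa using h1
  | succ k ih =>
    have hkd : (k : ℝ) + 1 ≤ d := by exact_mod_cast hk
    have hk0 : (0 : ℝ) ≤ k := Nat.cast_nonneg k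
    have h1 := mul_le_mul_of_nonneg_left (ih (by omega))
      (show (0 : ℝ) ≤ 2 * ((d : ℝ) - k) by linarith)
    have h2 : ((k + 1).factorial : ℝ) * (signVectors d (k + 1)).card =
        2 * ((d : ℝ) - k) * (k.factorial * (signVectors d k).card) := by
      rw [Nat.factorial_succ]
      push_cast
      linear_combination (k.factorial : ℝ) * succ_mul_card_signVectors d k
    rw [h2]
    refine le_trans ?_ h1
    have h3 : 2 * ((d : ℝ) - k) * ((2 * d : ℝ) ^ k * (1 - (k : ℝ) ^ 2 / (2 * d))) =
        (2 * d : ℝ) ^ (k + 1) * ((1 - k / d) * (1 - (k : ℝ) ^ 2 / (2 * d))) := by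
      field_simp
      ring
    rw [h3]
    gcongr
    push_cast
    have h4 : (1 - (k : ℝ) / d) * (1 - (k : ℝ) ^ 2 / (2 * d)) -
        (1 - ((k : ℝ) + 1) ^ 2 / (2 * d)) = 1 / (2 * d) + k ^ 3 / (2 * d ^ 2) := by
      field_simp
      ring
    have h5 : (0 : ℝ) ≤ 1 / (2 * d) + (k : ℝ) ^ 3 / (2 * (d : ℝ) ^ 2) := by positivity
    linarith

/-- The `k`-step random walk dominates a multiple of the average over sign vectors. -/
theorem sum_signVectors_le_walk_pow {d : ℕ} {f : RealL2 (Fin d → ℤ)} (hf : ∀ x, 0 ≤ f x)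
    (k : ℕ) (x : Fin d → ℤ) :
    k.factorial / (2 * d : ℝ) ^ k * ∑ y ∈ signVectors d k, f (x - y) ≤
      (RealL2.walk d ^ k) f x := by
  induction k generalizing x with
  | zero =>
    have h : signVectors d 0 = {0} := by
      ext y
      rw [mem_signVectors, Finset.mem_singleton]
      constructor
      · rintro ⟨-, h⟩
        funext i
        simpa using (Finset.sum_eq_zero_iff.mp h) i (Finset.mem_univ i)
      · rintro rfl
        simp [latticeNorm]
    simp [h]
  | succ k ih =>
    have h1 : (RealL2.walk d ^ (k + 1)) f = RealL2.walk d ((RealL2.walk d ^ k) f) := by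
      rw [pow_succ']
      rfl
    -- Only walks whose steps use pairwise distinct coordinates are kept; positivity discards the
    -- others.
    have h2 : ∀ (i : Fin d) (s : ℤ), k.factorial / (2 * d : ℝ) ^ k *
        ∑ y ∈ (signVectors d k).filter (fun y => y i = 0), f (x - (y + Pi.single i s)) ≤
          (RealL2.walk d ^ k) f (x - Pi.single i s) := by
      intro i s
      refine le_trans ?_ (ih _)
      refine mul_le_mul_of_nonneg_left ?_ (by positivity)
      have hxy : ∀ y : Fin d → ℤ, x - (y + Pi.single i s) = x - Pi.single i s - y :=
        fun y => by rw [sub_sub, add_comm]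
      simp only [hxy]
      exact Finset.sum_le_sum_of_subset_of_nonneg (Finset.filter_subset _ _) fun y _ _ => hf _
    rw [h1, RealL2.walk_apply, Nat.factorial_succ]
    calc _ = (2 * d : ℝ)⁻¹ * (k.factorial / (2 * d : ℝ) ^ k *
          (((k : ℝ) + 1) * ∑ y ∈ signVectors d (k + 1), f (x - y))) := by
          push_cast
          rw [pow_succ]
          ring
      _ ≤ _ := by
          rw [succ_mul_sum_signVectors fun y => f (x - y), Finset.mul_sum]
          gcongr with i
          rw [mul_add]
          exact add_le_add (h2 i 1) (h2 i (-1))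

/-! ### Splitting the lattice ball into sparse parts and sign vectors -/

theorem natAbs_le_latticeNorm {d : ℕ} (y : Fin d → ℤ) (i : Fin d) :
    (y i).natAbs ≤ latticeNorm y :=
  Finset.single_le_sum (f := fun i => (y i).natAbs) (fun _ _ => Nat.zero_le _) (Finset.mem_univ i)

theorem mem_latticeBallFinset {d N : ℕ} {y : Fin d → ℤ} :
    y ∈ latticeBallFinset d (N : ℝ) ↔ latticeNorm y ≤ N := by
  have h : ∑ i, |(y i : ℝ)| = (latticeNorm y : ℝ) := by
    simp only [latticeNorm, Nat.cast_sum, Nat.cast_natAbs, Int.cast_abs]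
  rw [latticeBallFinset, Set.Finite.mem_toFinset]
  change ∑ i, |(y i : ℝ)| ≤ N ↔ _
  rw [h, Nat.cast_le]

/-- Lattice points with entries in `[-d, d] \ {-1, 1}`. -/
noncomputable def sparseVectors (d : ℕ) : Finset (Fin d → ℤ) :=
  Fintype.piFinset fun _ => (Finset.Icc (-(d : ℤ)) d).filter fun j => j.natAbs ≠ 1

/-- The point `x` with its entries `±1` replaced by `0`. -/
def sparsePart {d : ℕ} (x : Fin d → ℤ) : Fin d → ℤ :=
  fun i => if (x i).natAbs = 1 then 0 else x i

theorem sub_sparsePart_apply {d : ℕ} (x : Fin d → ℤ) (i : Fin d) :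
    (x - sparsePart x) i = if (x i).natAbs = 1 then x i else 0 := by
  by_cases h : (x i).natAbs = 1 <;> simp [sparsePart, h]

theorem latticeNorm_sparsePart_add {d : ℕ} (x : Fin d → ℤ) :
    latticeNorm (sparsePart x) + latticeNorm (x - sparsePart x) = latticeNorm x := by
  simp only [latticeNorm, ← Finset.sum_add_distrib]
  refine Finset.sum_congr rfl fun i _ => ?_
  rw [sub_sparsePart_apply]
  by_cases h : (x i).natAbs = 1 <;> simp [sparsePart, h]

theorem sub_sparsePart_mem {d : ℕ} (x : Fin d → ℤ) :
    x - sparsePart x ∈ signVectors d (latticeNorm (x - sparsePart x)) := by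
  refine mem_signVectors.mpr ⟨fun i => ?_, rfl⟩
  rw [sub_sparsePart_apply]
  split_ifs with h
  · omega
  · simp

/-- Splitting off the entries `±1` of the points of a ball. -/
theorem sum_ball_le {d N : ℕ} (hN : N ≤ d) {g : (Fin d → ℤ) → ℝ} (hg : ∀ y, 0 ≤ g y) :
    ∑ x ∈ latticeBallFinset d (N : ℝ), g x ≤
      ∑ y ∈ sparseVectors d, ∑ k ∈ Finset.range (N + 1 - latticeNorm y),
        ∑ z ∈ signVectors d k, g (y + z) := by
  have hmaps : ∀ x ∈ latticeBallFinset d (N : ℝ), sparsePart x ∈ sparseVectors d := by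
    intro x hx
    have hx' := mem_latticeBallFinset.mp hx
    refine Fintype.mem_piFinset.mpr fun i => ?_
    have := natAbs_le_latticeNorm x i
    rw [Finset.mem_filter, Finset.mem_Icc]
    by_cases h : (x i).natAbs = 1 <;> simp only [sparsePart, h, if_true, if_false]
    · simp
    · omega
  rw [← Finset.sum_fiberwise_of_maps_to hmaps]
  refine Finset.sum_le_sum fun y _ => ?_
  -- The norms of the two parts add up to at most `N`; for `|y| > N` the truncated subtraction
  -- leaves an empty range.
  have hmaps' : ∀ x ∈ (latticeBallFinset d (N : ℝ)).filter (fun x => sparsePart x = y),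
      latticeNorm (x - y) ∈ Finset.range (N + 1 - latticeNorm y) := by
    intro x hx
    obtain ⟨hxN, rfl⟩ := Finset.mem_filter.mp hx
    have h1 := mem_latticeBallFinset.mp hxN
    have h2 := latticeNorm_sparsePart_add x
    rw [Finset.mem_range]
    omega
  rw [← Finset.sum_fiberwise_of_maps_to hmaps']
  refine Finset.sum_le_sum fun k _ => ?_
  set s := ((latticeBallFinset d (N : ℝ)).filter (fun x => sparsePart x = y)).filter
    fun x => latticeNorm (x - y) = k with hs
  calc ∑ x ∈ s, g x = ∑ z ∈ s.image (fun x => x - y), g (y + z) := by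
        rw [Finset.sum_image fun a _ b _ h => sub_left_injective h]
        exact Finset.sum_congr rfl fun x _ => by rw [add_sub_cancel]
    _ ≤ _ := by
        refine Finset.sum_le_sum_of_subset_of_nonneg (fun z hz => ?_) fun z _ _ => hg _
        obtain ⟨x, hx, rfl⟩ := Finset.mem_image.mp hz
        obtain ⟨hx, hk⟩ := Finset.mem_filter.mp hx
        obtain ⟨-, rfl⟩ := Finset.mem_filter.mp hx
        rw [← hk]
        exact sub_sparsePart_mem x

/-- The sign vectors with `N` nonzero entries already suffice: `N² ≤ d` keeps the loss factor at
least `1/2`. -/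
theorem card_ball_ge {d N : ℕ} (hd : 0 < d) (hNd : N ^ 2 ≤ d) :
    (2 * d : ℝ) ^ N / (2 * N.factorial) ≤ (latticeBallFinset d (N : ℝ)).card := by
  have hN : N ≤ d := (Nat.le_self_pow two_ne_zero N).trans hNd
  have h1 := factorial_mul_card_signVectors_ge hd hN
  have h2 : ((signVectors d N).card : ℝ) ≤ (latticeBallFinset d (N : ℝ)).card := by
    exact_mod_cast Finset.card_le_card fun y hy =>
      mem_latticeBallFinset.mpr (mem_signVectors.mp hy).2.le
  have hd' : (0 : ℝ) < d := by exact_mod_cast hd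
  have h3 : (1 : ℝ) / 2 ≤ 1 - (N : ℝ) ^ 2 / (2 * d) := by
    have : (N : ℝ) ^ 2 ≤ d := by exact_mod_cast hNd
    have : (N : ℝ) ^ 2 / (2 * d) ≤ 1 / 2 := by
      rw [div_le_div_iff₀ (by positivity) (by norm_num)]
      linarith
    linarith
  have h4 : (2 * d : ℝ) ^ N * (1 / 2) ≤ N.factorial * (signVectors d N).card :=
    (mul_le_mul_of_nonneg_left h3 (by positivity)).trans h1
  refine le_trans ?_ h2
  rw [div_le_iff₀ (by positivity)]
  linarith

/-- This holds because `N!/k! ≤ N^(N-k)`; it makes the layer `k` geometrically small in `N - k`. -/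
theorem factorial_div_mul_pow_le {d k N : ℕ} (hd : 0 < d) (hk : k ≤ N) {q : ℝ}
    (hq : (N : ℝ) / (2 * d) ≤ q) :
    N.factorial / (2 * d : ℝ) ^ N * ((2 * d : ℝ) ^ k / k.factorial) ≤ q ^ (N - k) := by
  have hd' : (0 : ℝ) < d := by exact_mod_cast hd
  obtain ⟨m, rfl⟩ := Nat.exists_eq_add_of_le hk
  have h1 : ((k + m).factorial : ℝ) ≤ k.factorial * ((k + m : ℕ) : ℝ) ^ m := by
    rw [← Nat.factorial_mul_ascFactorial]
    exact_mod_cast Nat.mul_le_mul_left _ (Nat.ascFactorial_le_pow_add k m)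
  rw [Nat.add_sub_cancel_left]
  calc _ = (k + m).factorial / (k.factorial * (2 * d : ℝ) ^ m) := by
        rw [pow_add]
        field_simp
    _ ≤ k.factorial * ((k + m : ℕ) : ℝ) ^ m / (k.factorial * (2 * d : ℝ) ^ m) := by gcongr
    _ = (((k + m : ℕ) : ℝ) / (2 * d)) ^ m := by
        rw [div_pow]
        field_simp
    _ ≤ q ^ m := by gcongr

theorem sum_pow_range_le {q : ℝ} (hq0 : 0 ≤ q) (hq : q ≤ 1 / 4) (m : ℕ) :
    ∑ j ∈ Finset.range m, q ^ j ≤ 4 / 3 := by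
  have h := Summable.sum_le_tsum (Finset.range m) (fun j _ => pow_nonneg hq0 j)
    (summable_geometric_of_lt_one hq0 (by linarith))
  rw [tsum_geometric_of_lt_one hq0 (by linarith)] at h
  refine h.trans ?_
  rw [inv_le_comm₀ (by linarith) (by norm_num)]
  linarith

theorem sum_pow_sub_le {q : ℝ} (hq0 : 0 ≤ q) (hq : q ≤ 1 / 4) (l N : ℕ) :
    ∑ k ∈ Finset.range (N + 1 - l), q ^ (N - k) ≤ 4 / 3 * q ^ l := by
  rcases Nat.lt_or_ge N l with h | h
  · rw [show N + 1 - l = 0 by omega]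
    simp
    positivity
  · rw [← Finset.sum_range_reflect]
    have h1 : ∀ j ∈ Finset.range (N + 1 - l), q ^ (N - (N + 1 - l - 1 - j)) = q ^ j * q ^ l := by
      intro j hj
      have := Finset.mem_range.mp hj
      rw [← pow_add]
      congr 1
      omega
    rw [Finset.sum_congr rfl h1, ← Finset.sum_mul]
    gcongr
    exact sum_pow_range_le hq0 hq _

/-- The averages over small balls are dominated by translates of a majorant of the walk. -/
theorem ball_average_le {d N : ℕ} (hd : 0 < d) (hNd : N ^ 2 ≤ d) {q : ℝ}
    (hNq : (N : ℝ) / (2 * d) ≤ q) (hq : q ≤ 1 / 4)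
    {f F : RealL2 (Fin d → ℤ)} (hf : ∀ x, 0 ≤ f x) (hF0 : ∀ x, 0 ≤ F x)
    (hF : ∀ n ≤ d, ∀ x, (RealL2.walk d ^ n) f x ≤ F x) (x : Fin d → ℤ) :
    (1 / ((latticeBallFinset d (N : ℝ)).card : ℝ)) *
        ∑ y ∈ latticeBallFinset d (N : ℝ), f (x - y) ≤
      8 / 3 * ∑ y ∈ sparseVectors d, q ^ latticeNorm y * F (x - y) := by
  have hd' : (0 : ℝ) < d := by exact_mod_cast hd
  have hq0 : 0 ≤ q := le_trans (by positivity) hNq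
  have hN : N ≤ d := (Nat.le_self_pow two_ne_zero N).trans hNd
  have hcard : 1 / ((latticeBallFinset d (N : ℝ)).card : ℝ) ≤
      2 * (N.factorial / (2 * d : ℝ) ^ N) := by
    refine (one_div_le_one_div_of_le (by positivity) (card_ball_ge hd hNd)).trans_eq ?_
    rw [one_div_div]
    ring
  have hwalk : ∀ k ≤ N, ∀ y, ∑ z ∈ signVectors d k, f (x - (y + z)) ≤
      (2 * d : ℝ) ^ k / k.factorial * F (x - y) := by
    intro k hk y
    have h1 := (sum_signVectors_le_walk_pow hf k (x - y)).trans (hF k (hk.trans hN) (x - y))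
    simp only [sub_sub] at h1
    rw [div_mul_eq_mul_div, div_le_iff₀ (by positivity)] at h1
    rw [div_mul_eq_mul_div, le_div_iff₀ (by positivity)]
    linarith
  -- The final `8/3` is 2, from the cardinality bound, times `4/3`, from the geometric sum over `k ≤
  -- N - |y|`.
  calc _ ≤ 2 * (N.factorial / (2 * d : ℝ) ^ N) * ∑ y ∈ sparseVectors d,
        ∑ k ∈ Finset.range (N + 1 - latticeNorm y),
          (2 * d : ℝ) ^ k / k.factorial * F (x - y) := by
        refine mul_le_mul hcard ?_ (Finset.sum_nonneg fun y _ => hf _) (by positivity)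
        refine (sum_ball_le hN fun y => hf (x - y)).trans ?_
        gcongr with y _ k hk
        have := Finset.mem_range.mp hk
        exact hwalk k (by omega) y
    _ = 2 * ∑ y ∈ sparseVectors d, (∑ k ∈ Finset.range (N + 1 - latticeNorm y),
          N.factorial / (2 * d : ℝ) ^ N * ((2 * d : ℝ) ^ k / k.factorial)) * F (x - y) := by
        rw [mul_assoc, Finset.mul_sum]
        congr 1
        refine Finset.sum_congr rfl fun y _ => ?_
        rw [← Finset.sum_mul, ← Finset.mul_sum, mul_assoc]
    _ ≤ 2 * ∑ y ∈ sparseVectors d, (4 / 3 * q ^ latticeNorm y) * F (x - y) := by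
        gcongr with y _
        · exact hF0 _
        · refine le_trans (Finset.sum_le_sum fun k hk => ?_) (sum_pow_sub_le hq0 hq _ N)
          have := Finset.mem_range.mp hk
          exact factorial_div_mul_pow_le hd (by omega) hNq
    _ = _ := by
        rw [Finset.mul_sum, Finset.mul_sum]
        exact Finset.sum_congr rfl fun y _ => by ring

/-- The entry 0 contributes 1 and the entries of size at least 2 contribute at most `(8/3) q² ≤
1/d`. Entries `±1` would add `2q`, which can be of order `1/√d` and is too large for a `d`-fold
product. -/
theorem sum_sparse_entry_le {d : ℕ} (hd : 0 < d) {q : ℝ} (hq0 : 0 ≤ q) (hq : q ≤ 1 / 4)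
    (hqd : 4 * q ^ 2 * d ≤ 1) :
    ∑ j ∈ (Finset.Icc (-(d : ℤ)) d).filter (fun j => j.natAbs ≠ 1), q ^ j.natAbs ≤
      1 + 1 / d := by
  have hd' : (0 : ℝ) < d := by exact_mod_cast hd
  set U : Finset ℤ := (Finset.range d).image fun k : ℕ => (k : ℤ) + 2
  set V : Finset ℤ := (Finset.range d).image fun k : ℕ => -((k : ℤ) + 2)
  have hsub : (Finset.Icc (-(d : ℤ)) d).filter (fun j => j.natAbs ≠ 1) ⊆ {0} ∪ (U ∪ V) := by
    intro j hj
    rw [Finset.mem_filter, Finset.mem_Icc] at hj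
    simp only [Finset.mem_union, Finset.mem_singleton, U, V, Finset.mem_image, Finset.mem_range]
    rcases lt_trichotomy j 0 with h | h | h
    · exact Or.inr (Or.inr ⟨j.natAbs - 2, by omega, by omega⟩)
    · exact Or.inl h
    · exact Or.inr (Or.inl ⟨j.natAbs - 2, by omega, by omega⟩)
  have hgeom : ∑ k ∈ Finset.range d, q ^ (k + 2) ≤ q ^ 2 * (4 / 3) := by
    simp only [pow_add]
    rw [← Finset.sum_mul, mul_comm]
    gcongr
    exact sum_pow_range_le hq0 hq d
  have hU : ∑ j ∈ U, q ^ j.natAbs ≤ q ^ 2 * (4 / 3) := by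
    refine le_trans (le_of_eq ?_) hgeom
    rw [Finset.sum_image fun a _ b _ h => by simpa using h]
    exact Finset.sum_congr rfl fun k _ => by congr 1
  have hV : ∑ j ∈ V, q ^ j.natAbs ≤ q ^ 2 * (4 / 3) := by
    refine le_trans (le_of_eq ?_) hgeom
    rw [Finset.sum_image fun a _ b _ h => by simpa using h]
    exact Finset.sum_congr rfl fun k _ => by congr 1
  have hunion : ∀ A B : Finset ℤ, ∑ j ∈ A ∪ B, q ^ j.natAbs ≤
      ∑ j ∈ A, q ^ j.natAbs + ∑ j ∈ B, q ^ j.natAbs := by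
    intro A B
    rw [← Finset.sum_union_inter]
    exact le_add_of_nonneg_right (Finset.sum_nonneg fun j _ => pow_nonneg hq0 _)
  have h0 : ∑ j ∈ ({0} : Finset ℤ), q ^ j.natAbs = 1 := by simp
  have hqd' : 4 * q ^ 2 ≤ 1 / d := by
    rw [le_div_iff₀ hd']
    exact hqd
  have h1 := Finset.sum_le_sum_of_subset_of_nonneg (f := fun j : ℤ => q ^ j.natAbs) hsub
    fun j _ _ => pow_nonneg hq0 _
  have h2 := hunion {0} (U ∪ V)
  have h3 := hunion U V
  nlinarith [sq_nonneg q]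

/-- The sum factors over the coordinates, and `(1 + 1/d)^d ≤ e`. -/
theorem sum_sparseVectors_pow_le {d : ℕ} (hd : 0 < d) {q : ℝ} (hq0 : 0 ≤ q) (hq : q ≤ 1 / 4)
    (hqd : 4 * q ^ 2 * d ≤ 1) : ∑ y ∈ sparseVectors d, q ^ latticeNorm y ≤ 3 := by
  have hd' : (0 : ℝ) < d := by exact_mod_cast hd
  simp only [latticeNorm, ← Finset.prod_pow_eq_pow_sum]
  rw [sparseVectors,
    ← Finset.prod_univ_sum (fun _ : Fin d => _) fun _ (j : ℤ) => q ^ j.natAbs,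
    Finset.prod_const, Finset.card_univ, Fintype.card_fin]
  calc _ ≤ (1 + 1 / (d : ℝ)) ^ d :=
        pow_le_pow_left₀ (Finset.sum_nonneg fun j _ => pow_nonneg hq0 _)
          (sum_sparse_entry_le hd hq0 hq hqd) d
    _ ≤ Real.exp (1 / d) ^ d := by
        gcongr
        linarith [Real.add_one_le_exp (1 / (d : ℝ))]
    _ = Real.exp 1 := by
        rw [← Real.exp_nat_mul]
        congr 1
        field_simp
    _ ≤ 3 := by linarith [Real.exp_one_lt_d9]

/-! ### The maximal inequality -/

theorem theorem1p3 (d : ℕ) (hd : 4 ≤ d) (f : lp (fun _ : Fin d → ℤ => ℂ) 2) :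
    ∃ h : Memℓp (smallDyadicMax (f : (Fin d → ℤ) → ℂ)) 2,
      ‖(⟨smallDyadicMax (f : (Fin d → ℤ) → ℂ), h⟩ : lp (fun _ : Fin d → ℤ => ℝ) 2)‖ ≤
        900 * ‖f‖ := by
  have hd0 : 0 < d := by omega
  have hd' : (0 : ℝ) < d := by exact_mod_cast hd0
  have hsqrt : 0 < √(d : ℝ) := Real.sqrt_pos.mpr hd'
  have hsq : √(d : ℝ) ^ 2 = d := Real.sq_sqrt hd'.le
  have hsqrt2 : 2 ≤ √(d : ℝ) := by
    rw [Real.le_sqrt' two_pos]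
    exact_mod_cast (show 2 ^ 2 ≤ d by omega)
  -- This `q` bounds `N/(2d)` for every `N ≤ √d`, so `W` below serves all radii at once; `d ≥ 4`
  -- gives `q ≤ 1/4`.
  set q : ℝ := 1 / (2 * √(d : ℝ)) with hqdef
  have hq0 : 0 ≤ q := by positivity
  have hq : q ≤ 1 / 4 := one_div_le_one_div_of_le (by norm_num) (by linarith)
  have hqd : 4 * q ^ 2 * d ≤ 1 := by
    rw [hqdef, div_pow, mul_pow, hsq]
    apply le_of_eq
    field_simp
    norm_num
  set a : RealL2 (Fin d → ℤ) := lp.toNorm f with ha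
  have haval : ∀ x, a x = ‖f x‖ := fun x => rfl
  have ha0 : ∀ x, 0 ≤ a x := fun x => norm_nonneg (f x)
  have hanorm : ‖a‖ = ‖f‖ := lp.norm_toNorm
  obtain ⟨F, hF, hF0, hFle⟩ := (RealL2.isSymmPosContraction_walk d).exists_power_majorant d ha0
  set W : RealL2 (Fin d → ℤ) :=
    (8 / 3 : ℝ) • ∑ y ∈ sparseVectors d, q ^ latticeNorm y • RealL2.shift y F with hW
  have hWval : ∀ x, W x = 8 / 3 * ∑ y ∈ sparseVectors d, q ^ latticeNorm y * F (x - y) := by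
    intro x
    rw [hW, lp.coeFn_smul, Pi.smul_apply, RealL2.sum_apply, smul_eq_mul]
    rfl
  -- The constants multiply to `8/3 · 3 · 26 = 208`.
  have hWnorm : ‖W‖ ≤ 900 * ‖f‖ := by
    have h1 : ‖∑ y ∈ sparseVectors d, q ^ latticeNorm y • RealL2.shift y F‖ ≤
        (∑ y ∈ sparseVectors d, q ^ latticeNorm y) * ‖F‖ := by
      rw [Finset.sum_mul]
      refine norm_sum_le_of_le _ fun y _ => ?_
      rw [norm_smul, RealL2.norm_shift, Real.norm_of_nonneg (pow_nonneg hq0 _)]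
    have h2 := mul_le_mul_of_nonneg_right (sum_sparseVectors_pow_le hd0 hq0 hq hqd)
      (norm_nonneg F)
    rw [hW, norm_smul, Real.norm_of_nonneg (by norm_num)]
    rw [hanorm] at hF
    linarith [norm_nonneg f]
  have hWnonneg : ∀ x, 0 ≤ W x := fun x => by
    rw [hWval]
    exact mul_nonneg (by norm_num) (Finset.sum_nonneg fun y _ =>
      mul_nonneg (pow_nonneg hq0 _) (hF0 _))
  have hmaxle : ∀ x, smallDyadicMax (f : (Fin d → ℤ) → ℂ) x ≤ W x := by
    intro x
    refine Real.iSup_le (fun t => ?_) (hWnonneg x)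
    obtain ⟨t, ⟨n, rfl⟩, ht⟩ := t
    have hNd : (2 ^ n) ^ 2 ≤ d := by
      have := (Real.le_sqrt' (by positivity)).mp ht
      exact_mod_cast this
    have hNq : ((2 ^ n : ℕ) : ℝ) / (2 * d) ≤ q := by
      rw [hqdef, div_le_div_iff₀ (by positivity) (by positivity)]
      push_cast
      nlinarith
    have hball := ball_average_le hd0 hNd hNq hq ha0 hF0 hFle x
    push_cast at hball
    rw [hWval]
    refine le_trans ?_ hball
    rw [discreteAvg, norm_mul, norm_div, norm_one, Complex.norm_natCast]
    gcongr
    exact norm_sum_le _ _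
  have hmax0 : ∀ x, 0 ≤ smallDyadicMax (f : (Fin d → ℤ) → ℂ) x := fun x =>
    Real.iSup_nonneg fun t => norm_nonneg _
  have hmem : Memℓp (smallDyadicMax (f : (Fin d → ℤ) → ℂ)) 2 :=
    (lp.memℓp W).mono' fun x => by
      rw [Real.norm_of_nonneg (hmax0 x), Real.norm_of_nonneg (hWnonneg x)]
      exact hmaxle x
  refine ⟨hmem, le_trans (RealL2.norm_le_of_abs_le fun x => ?_) hWnorm⟩
  change |smallDyadicMax (f : (Fin d → ℤ) → ℂ) x| ≤ |W x|
  rw [abs_of_nonneg (hmax0 x), abs_of_nonneg (hWnonneg x)]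
  exact hmaxle x
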